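/- Let $H^2(\mathbb D)$ and $H^2(\mathbb D^2)$ denote the Hardy spaces of the unit disc and of the bidisc, identified through boundary values with the closed subspaces of $L^2(\mathbb T)$ and $L^2(\mathbb T^2)$ (normalized Lebesgue measure) of functions whose Fourier coefficients vanish unless all their indices are nonnegative. Let $T$ be the multiplication by the coordinate on $H^2(\mathbb D)$, and let $M_1,M_2$ be the multiplications by the coordinates $z,w$ on $H^2(\mathbb D^2)$. A quotient module of $H^2(\mathbb D)$ (resp. $H^2(\mathbb D^2)$) is a closed subspace invariant under $T^*$ (resp. under $M_1^*$ and $M_2^*$). For a quotient module $\mathfrak Q$ of $H^2(\mathbb D^2)$ put $Q_i=P_{\mathfrak Q}M_i|_{\mathfrak Q}$, $i=1,2$, where $P_{\mathfrak Q}$ is the orthogonal projection onto $\mathfrak Q$; $\mathfrak Q$ is nontrivial if $\mathfrak Q\neq\{0\}$, doubly commuting if $Q_1^*Q_2=Q_2Q_1^*$, and $\varphi$-doubly commuting if $Q_1Q_2Q_2^*=Q_2^*Q_1Q_2$. For subspaces $\mathfrak Q_1,\mathfrak Q_2$ of $H^2(\mathbb D)$, $\mathfrak Q_1\otimes\mathfrak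 Q_2\subseteq H^2(\mathbb D^2)$ denotes the closed linear span of the functions $f(z)g(w)$ with $f\in\mathfrak Q_1$, $g\in\mathfrak Q_2$. An inner function $\theta$ on $\mathbb D$ is a bounded holomorphic function with boundary values of modulus $1$ almost everywhere on $\mathbb T$. For $a\in\mathbb D$ and $c\in\mathbb T$ let $f_{a,c}(z)=c\,\dfrac{z-a}{1-\bar a z}$. **Theorem 3.5.** Let $\mathfrak Q_1,\mathfrak Q_2$ be quotient modules of $H^2(\mathbb D)$ such that $\mathfrak Q=\mathfrak Q_1\otimes\mathfrak Q_2$ is a nontrivial doubly commuting quotient module of $H^2(\mathbb D^2)$. Then $\mathfrak Q$ is $\varphi$-doubly commuting if and only if one of the following holds: (i) $\mathfrak Q_1=H^2(\mathbb D)$ and $\mathfrak Q_2=H^2(\mathbb D)\ominus f_{a,c}H^2(\mathbb D)$ for some $a\in\mathbb D$, $c\in\mathbb T$; (ii) $\mathfrak Q_1=H^2(\mathbb D)\ominus f_{0,c}H^2(\mathbb D)$ for some $c\in\mathbb T$, and $\mathfrak Q_2=H^2(\mathbb D)$; (iii) $\mathfrak Q_1=H^2(\mathbb D)\ominus\theta_1H^2(\mathbb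 D)$ and $\mathfrak Q_2=H^2(\mathbb D)\ominus\theta_2H^2(\mathbb D)$ for some inner functions $\theta_1,\theta_2$ on $\mathbb D$ such that $\theta_1=f_{0,c}$ for some $c\in\mathbb T$, or $\theta_2=f_{a,c}$ for some $a\in\mathbb D$, $c\in\mathbb T$. -/

import Mathlib

open MeasureTheory AddCircle
open scoped ComplexConjugate ENNReal InnerProductSpace InnerProduct

noncomputable section

/-! ### Generalities: compressions and quotient modules of a Hilbert module -/

section HilbertModule

variable {H : Type*} [NormedAddCommGroup H] [InnerProductSpace ℂ H] [CompleteSpace H]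

/-- A closed subspace `Q` of a Hilbert space is a quotient module, with respect to a family `M` of
module multiplication operators, if it is invariant under the adjoints of these operators. -/
structure IsQuotientModule (M : Set (H →L[ℂ] H)) (Q : Submodule ℂ H) : Prop where
  isClosed : IsClosed (Q : Set H)
  adjoint_mem : ∀ T ∈ M, ∀ f ∈ Q, ContinuousLinearMap.adjoint T f ∈ Q

/-- The compression `P_Q T |_Q` of an operator `T` to a closed subspace `Q`. -/
def compression (Q : Submodule ℂ H) [CompleteSpace Q] (T : H →L[ℂ] H) : Q →L[ℂ] Q :=
  Q.orthogonalProjectionOnto ∘L T ∘L Q.subtypeL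

/-- `[Q₁^*, Q₂] = 0`, where `Q₁`, `Q₂` are the compressions to `Q` of `M₁`, `M₂`. -/
def IsDoublyCommuting (M₁ M₂ : H →L[ℂ] H) (Q : Submodule ℂ H) [CompleteSpace Q] : Prop :=
  ContinuousLinearMap.adjoint (compression Q M₁) ∘L compression Q M₂ =
    compression Q M₂ ∘L ContinuousLinearMap.adjoint (compression Q M₁)

/-- `Q₁ Q₂ Q₂^* = Q₂^* Q₁ Q₂`, where `Q₁`, `Q₂` are the compressions to `Q` of `M₁`, `M₂`. -/
def IsPhiDoublyCommuting (M₁ M₂ : H →L[ℂ] H) (Q : Submodule ℂ H) [CompleteSpace Q] : Prop :=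
  compression Q M₁ ∘L compression Q M₂ ∘L ContinuousLinearMap.adjoint (compression Q M₂) =
    ContinuousLinearMap.adjoint (compression Q M₂) ∘L compression Q M₁ ∘L compression Q M₂

end HilbertModule

/-! ### Multiplication by a continuous function on `L²` -/

section Multiplication

variable {X : Type*} [TopologicalSpace X] [CompactSpace X]
  [MeasurableSpace X] [BorelSpace X] (μ : Measure X) [IsFiniteMeasure μ]

/-- Multiplication by the continuous function `u` as an operator on `L²(μ)`. -/
def mulL2 (u : C(X, ℂ)) : Lp ℂ 2 μ →L[ℂ] Lp ℂ 2 μ :=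
  (ContinuousLinearMap.mul ℂ ℂ).holderL μ ∞ 2 2 (ContinuousMap.toLp (E := ℂ) ∞ μ ℂ u)

theorem mulL2_ae (u : C(X, ℂ)) (f : Lp ℂ 2 μ) : mulL2 μ u f =ᵐ[μ] fun x => u x * f x := by
  have h1 := (ContinuousLinearMap.mul ℂ ℂ).coeFn_holder (r := 2)
    (ContinuousMap.toLp (E := ℂ) ∞ μ ℂ u) f
  have h2 := ContinuousMap.coeFn_toLp (p := ∞) (𝕜 := ℂ) μ u
  filter_upwards [h1, h2] with x hx1 hx2
  exact hx1.trans (by rw [ContinuousLinearMap.mul_apply', hx2])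

theorem inner_mulL2 (u v w : C(X, ℂ)) (h : ∀ x, conj (v x) * u x = conj (w x)) (f : Lp ℂ 2 μ) :
    inner ℂ (ContinuousMap.toLp (E := ℂ) 2 μ ℂ v) (mulL2 μ u f) =
      inner ℂ (ContinuousMap.toLp (E := ℂ) 2 μ ℂ w) f := by
  rw [L2.inner_def, L2.inner_def]
  refine integral_congr_ae ?_
  filter_upwards [mulL2_ae μ u f, ContinuousMap.coeFn_toLp (p := 2) (𝕜 := ℂ) μ v,
    ContinuousMap.coeFn_toLp (p := 2) (𝕜 := ℂ) μ w] with x h1 h2 h3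
  simp only [RCLike.inner_apply, h1, h2, h3, ← h]
  ring

end Multiplication

/-! ### The Hardy space of the disc

The circle is `UnitAddCircle = ℝ/ℤ` with normalized Lebesgue measure, its coordinate function is
`z = fourier 1`, that is `t ↦ exp (2 π i t)`. Hardy space functions are represented by their boundary
values. -/

/-- Normalized Lebesgue measure on the circle. -/
abbrev circleMeasure : Measure UnitAddCircle := haarAddCircle

/-- `H²(𝔻)`: the functions in `L²(𝕋)` all of whose Fourier coefficients of negative index vanish. -/
def hardyDisc : Submodule ℂ (Lp ℂ 2 circleMeasure) where
  carrier := {f | ∀ n : ℤ, n < 0 → inner ℂ (fourierLp 2 n) f = 0}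
  add_mem' hf hg n hn := by rw [inner_add_right, hf n hn, hg n hn, add_zero]
  zero_mem' n _ := inner_zero_right _
  smul_mem' c f hf n hn := by rw [inner_smul_right, hf n hn, mul_zero]

theorem isClosed_hardyDisc : IsClosed (hardyDisc : Set (Lp ℂ 2 circleMeasure)) := by
  have : (hardyDisc : Set (Lp ℂ 2 circleMeasure)) =
      ⋂ n : ℤ, ⋂ _ : n < 0, {f | inner ℂ (fourierLp 2 n) f = 0} := by
    ext f; simp [hardyDisc]
  rw [this]
  exact isClosed_iInter fun n => isClosed_iInter fun _ =>
    isClosed_eq (by fun_prop) continuous_const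

instance : CompleteSpace hardyDisc := isClosed_hardyDisc.completeSpace_coe

/-- The shift `T_z` on `H²(𝔻)`: multiplication by the coordinate function. -/
def hardyShift : hardyDisc →L[ℂ] hardyDisc :=
  (mulL2 circleMeasure (fourier 1) ∘L hardyDisc.subtypeL).codRestrict hardyDisc <| by
    intro f n hn
    have h := inner_mulL2 circleMeasure (fourier 1) (fourier n) (fourier (n - 1))
      (fun x => by
        rw [← fourier_neg, ← fourier_neg, ← fourier_add]; congr 2; ring) (f : Lp ℂ 2 circleMeasure)
    exact h.trans (f.2 (n - 1) (by omega))

/-- `θ` is (the boundary function on the circle of) an inner function on the disc: a measurable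
unimodular function all of whose Fourier coefficients of negative index vanish. -/
structure IsInner (θ : UnitAddCircle → ℂ) : Prop where
  aestronglyMeasurable : AEStronglyMeasurable θ circleMeasure
  norm_eq_one : ∀ᵐ t ∂circleMeasure, ‖θ t‖ = 1
  fourierCoeff_eq_zero : ∀ n : ℤ, n < 0 → fourierCoeff θ n = 0

/-- `θ H²(𝔻)`, as a subspace of `H²(𝔻)`. -/
def mulHardy (θ : UnitAddCircle → ℂ) : Submodule ℂ hardyDisc where
  carrier := {f | ∃ g : hardyDisc,
    (f : Lp ℂ 2 circleMeasure) =ᵐ[circleMeasure] fun t => θ t * (g : Lp ℂ 2 circleMeasure) t}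
  add_mem' := by
    rintro f₁ f₂ ⟨g₁, h₁⟩ ⟨g₂, h₂⟩
    refine ⟨g₁ + g₂, ?_⟩
    filter_upwards [h₁, h₂, Lp.coeFn_add (f₁ : Lp ℂ 2 circleMeasure) (f₂ : Lp ℂ 2 circleMeasure),
      Lp.coeFn_add (g₁ : Lp ℂ 2 circleMeasure) (g₂ : Lp ℂ 2 circleMeasure)] with t a b c d
    simp only [Submodule.coe_add, c, d, Pi.add_apply, a, b, mul_add]
  zero_mem' := by
    refine ⟨0, ?_⟩
    filter_upwards [Lp.coeFn_zero ℂ 2 circleMeasure] with t a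
    have h0 : ((0 : Lp ℂ 2 circleMeasure) : UnitAddCircle → ℂ) t = 0 := a
    rw [ZeroMemClass.coe_zero, h0, mul_zero]
  smul_mem' := by
    rintro c f ⟨g, h⟩
    refine ⟨c • g, ?_⟩
    filter_upwards [h, Lp.coeFn_smul c (f : Lp ℂ 2 circleMeasure),
      Lp.coeFn_smul c (g : Lp ℂ 2 circleMeasure)] with t a b d
    simp only [Submodule.coe_smul, b, d, Pi.smul_apply, a, smul_eq_mul]
    ring

/-- The model space `H²(𝔻) ⊖ θ H²(𝔻)`. -/
def modelSpace (θ : UnitAddCircle → ℂ) : Submodule ℂ hardyDisc := (mulHardy θ)ᗮ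

/-- The boundary function of the automorphism `z ↦ c (z - a) / (1 - conj a * z)` of the disc,
where `|a| < 1` and `|c| = 1`. -/
def discAut (a c : ℂ) (t : UnitAddCircle) : ℂ :=
  c * ((fourier 1 t - a) / (1 - conj a * fourier 1 t))

/-! ### The Hardy space of the bidisc -/

/-- Normalized Lebesgue measure on the torus. -/
abbrev torusMeasure : Measure (UnitAddCircle × UnitAddCircle) := circleMeasure.prod circleMeasure

/-- The monomial `z ^ m * w ^ n` on the torus. -/
def torusMonomial (m n : ℤ) : C(UnitAddCircle × UnitAddCircle, ℂ) where
  toFun p := fourier m p.1 * fourier n p.2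

/-- `H²(𝔻²)`: the functions in `L²(𝕋²)` all of whose Fourier coefficients of index `(m, n)` with
`m < 0` or `n < 0` vanish. -/
def hardyBidisc : Submodule ℂ (Lp ℂ 2 torusMeasure) where
  carrier := {f | ∀ m n : ℤ, m < 0 ∨ n < 0 →
    inner ℂ (ContinuousMap.toLp (E := ℂ) 2 torusMeasure ℂ (torusMonomial m n)) f = 0}
  add_mem' hf hg m n h := by rw [inner_add_right, hf m n h, hg m n h, add_zero]
  zero_mem' m n _ := inner_zero_right _
  smul_mem' c f hf m n h := by rw [inner_smul_right, hf m n h, mul_zero]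

theorem isClosed_hardyBidisc : IsClosed (hardyBidisc : Set (Lp ℂ 2 torusMeasure)) := by
  have : (hardyBidisc : Set (Lp ℂ 2 torusMeasure)) =
      ⋂ m : ℤ, ⋂ n : ℤ, ⋂ _ : m < 0 ∨ n < 0,
        {f | inner ℂ (ContinuousMap.toLp (E := ℂ) 2 torusMeasure ℂ (torusMonomial m n)) f = 0} := by
    ext f; simp [hardyBidisc]
  rw [this]
  exact isClosed_iInter fun m => isClosed_iInter fun n => isClosed_iInter fun _ =>
    isClosed_eq (by fun_prop) continuous_const

instance : CompleteSpace hardyBidisc := isClosed_hardyBidisc.completeSpace_coe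

/-- `M₁` on `H²(𝔻²)`: multiplication by the first coordinate `z`. -/
def bidiscShift₁ : hardyBidisc →L[ℂ] hardyBidisc :=
  (mulL2 torusMeasure (torusMonomial 1 0) ∘L hardyBidisc.subtypeL).codRestrict hardyBidisc <| by
    intro f m n h
    have h' := inner_mulL2 torusMeasure (torusMonomial 1 0) (torusMonomial m n)
      (torusMonomial (m - 1) n) (fun x => by
        have : fourier (-(m - 1)) x.1 = fourier (-m) x.1 * fourier 1 x.1 := by
          rw [← fourier_add]; congr 2; ring
        simp only [torusMonomial, ContinuousMap.coe_mk, map_mul, ← fourier_neg, fourier_zero, this]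
        ring) (f : Lp ℂ 2 torusMeasure)
    exact h'.trans (f.2 (m - 1) n (by omega))

/-- `M₂` on `H²(𝔻²)`: multiplication by the second coordinate `w`. -/
def bidiscShift₂ : hardyBidisc →L[ℂ] hardyBidisc :=
  (mulL2 torusMeasure (torusMonomial 0 1) ∘L hardyBidisc.subtypeL).codRestrict hardyBidisc <| by
    intro f m n h
    have h' := inner_mulL2 torusMeasure (torusMonomial 0 1) (torusMonomial m n)
      (torusMonomial m (n - 1)) (fun x => by
        have : fourier (-(n - 1)) x.2 = fourier (-n) x.2 * fourier 1 x.2 := by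
          rw [← fourier_add]; congr 2; ring
        simp only [torusMonomial, ContinuousMap.coe_mk, map_mul, ← fourier_neg, fourier_zero, this]
        ring) (f : Lp ℂ 2 torusMeasure)
    exact h'.trans (f.2 m (n - 1) (by omega))

/-! ### Tensor products of subspaces -/

theorem memLp_pureTensor (f g : Lp ℂ 2 circleMeasure) :
    MemLp (fun p : UnitAddCircle × UnitAddCircle => f p.1 * g p.2) 2 torusMeasure := by
  have hf := Lp.memLp f
  have hg := Lp.memLp g
  refine (memLp_two_iff_integrable_sq_norm (hf.1.comp_fst.mul hg.1.comp_snd)).2 ?_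
  refine (((memLp_two_iff_integrable_sq_norm hf.1).1 hf).mul_prod
    ((memLp_two_iff_integrable_sq_norm hg.1).1 hg)).congr (Filter.Eventually.of_forall fun p => ?_)
  simp [mul_pow]

/-- The function `(z, w) ↦ f z * g w`, for `f, g` in `H²(𝔻)`, as an element of `H²(𝔻²)`. -/
def pureTensor (f g : hardyDisc) : hardyBidisc :=
  ⟨(memLp_pureTensor f g).toLp, by
    intro m n h
    have key : inner ℂ (ContinuousMap.toLp (E := ℂ) 2 torusMeasure ℂ (torusMonomial m n))
        (memLp_pureTensor f g).toLp =
        inner ℂ (fourierLp 2 m) (f : Lp ℂ 2 circleMeasure) *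
          inner ℂ (fourierLp 2 n) (g : Lp ℂ 2 circleMeasure) := by
      rw [L2.inner_def, L2.inner_def, L2.inner_def, ← integral_prod_mul]
      refine integral_congr_ae ?_
      have hm : ∀ᵐ p ∂torusMeasure, fourierLp (T := 1) 2 m p.1 = fourier m p.1 :=
        Measure.quasiMeasurePreserving_fst.ae (coeFn_fourierLp 2 m)
      have hn : ∀ᵐ p ∂torusMeasure, fourierLp (T := 1) 2 n p.2 = fourier n p.2 :=
        Measure.quasiMeasurePreserving_snd.ae (coeFn_fourierLp 2 n)
      filter_upwards [(memLp_pureTensor f g).coeFn_toLp,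
        ContinuousMap.coeFn_toLp (p := 2) (𝕜 := ℂ) torusMeasure (torusMonomial m n), hm, hn]
        with p h1 h2 h3 h4
      simp only [RCLike.inner_apply, h1, h2, h3, h4]
      simp only [torusMonomial, ContinuousMap.coe_mk, map_mul]
      ring
    rw [key]
    rcases h with h | h
    · rw [f.2 m h, zero_mul]
    · rw [g.2 n h, mul_zero]⟩

/-- `Q₁ ⊗ Q₂` under the identification `H²(𝔻²) = H²(𝔻) ⊗ H²(𝔻)`: the closed linear span of the
functions `f z * g w` with `f` in `Q₁` and `g` in `Q₂`. -/
def tensorSubspace (Q₁ Q₂ : Submodule ℂ hardyDisc) : Submodule ℂ hardyBidisc :=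
  (Submodule.span ℂ {F | ∃ f ∈ Q₁, ∃ g ∈ Q₂, F = pureTensor f g}).topologicalClosure

instance (Q₁ Q₂ : Submodule ℂ hardyDisc) : CompleteSpace (tensorSubspace Q₁ Q₂) :=
  inferInstanceAs (CompleteSpace (Submodule.topologicalClosure _))

end

noncomputable section

/-! ### Compressions to a quotient module. -/

section Compression

variable {H : Type*} [NormedAddCommGroup H] [InnerProductSpace ℂ H]

open ContinuousLinearMap (adjoint adjoint_inner_left adjoint_inner_right)

/-! Let A and B be the compressions of the shift T to the two factors. On elementary tensors the
compressed coordinate multiplications act as A ⊗ I and I ⊗ B, so φ-double commutation reads A ⊗ (BB*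
- B*B) = 0, that is, A = 0 or B is normal (`eq_zero_or_normal_of_isPhiDoublyCommuting`).

Both alternatives make a factor a space of eigenvectors of T*. Since the factor is T*-invariant, A*
is the restriction of T*, and A = 0 means eigenvalue 0. If B is normal, the rank-one defect I - TT*
forces the second factor to have dimension at most one (`exists_eigenvalue_of_normal`). An
eigenvector of T* has geometric Fourier coefficients, so its eigenvalue lies in the open disc and
its eigenspace is a line. For eigenvalue `conj a` that line is the complement of (T - a)H², which
equals f_{a,c}H² because I - `conj a` T is invertible (`mem_modelSpace_discAut`).

The other factor is unconstrained: it is all of H² or, by Beurling's theorem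
(`exists_eq_modelSpace`), a model space. This gives the three cases. Conversely, A = 0 or scalar B
yields the identity at once. -/

theorem inner_coe_compression {Q : Submodule ℂ H} [CompleteSpace Q] (T : H →L[ℂ] H) (f g : Q) :
    inner ℂ (f : H) (compression Q T g : H) = inner ℂ (f : H) (T g) :=
  Submodule.inner_orthogonalProjectionOnto_eq_of_mem_left f (T g)

variable [CompleteSpace H]

/-- Invariance of `Q` under the adjoint makes the projection superfluous: the adjoint of the
compression is a plain restriction. -/
theorem coe_adjoint_compression {M : Set (H →L[ℂ] H)} {Q : Submodule ℂ H} [CompleteSpace Q]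
    (hQ : IsQuotientModule M Q) {T : H →L[ℂ] H} (hT : T ∈ M) (f : Q) :
    (adjoint (compression Q T) f : H) = adjoint T (f : H) := by
  have h : adjoint (compression Q T) f = ⟨adjoint T (f : H), hQ.adjoint_mem T hT f f.2⟩ := by
    refine ext_inner_left ℂ fun g => ?_
    rw [adjoint_inner_right, Submodule.coe_inner, Submodule.coe_inner,
      adjoint_inner_right, ← inner_conj_symm, inner_coe_compression, inner_conj_symm]
  rw [h]

/-- If the adjoint of `T` acts on a quotient module as a scalar, so does the compression of `T`. -/
theorem compression_eq_smul {M : Set (H →L[ℂ] H)} {Q : Submodule ℂ H} [CompleteSpace Q]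
    (hQ : IsQuotientModule M Q) {T : H →L[ℂ] H} (hT : T ∈ M) {a : ℂ}
    (h : ∀ f ∈ Q, adjoint T f = conj a • f) :
    compression Q T = a • ContinuousLinearMap.id ℂ Q := by
  ext1 f
  refine ext_inner_left ℂ fun g => ?_
  rw [← adjoint_inner_left, Submodule.coe_inner, coe_adjoint_compression hQ hT, h g g.2]
  simp [inner_smul_left, inner_smul_right]

/-- The scalar 0 is kept explicit so that a vanishing compression becomes the eigenvalue condition
with eigenvalue 0. -/
theorem compression_eq_zero_iff {M : Set (H →L[ℂ] H)} {Q : Submodule ℂ H} [CompleteSpace Q]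
    (hQ : IsQuotientModule M Q) {T : H →L[ℂ] H} (hT : T ∈ M) :
    compression Q T = 0 ↔ ∀ f ∈ Q, adjoint T f = (0 : ℂ) • f := by
  constructor
  · intro h f hf
    have h1 := coe_adjoint_compression hQ hT ⟨f, hf⟩
    rw [h, map_zero] at h1
    rw [zero_smul]
    exact h1.symm
  · intro h
    rw [compression_eq_smul hQ hT (a := 0) (by simpa using h)]
    exact ContinuousLinearMap.ext fun f => zero_smul ℂ f

end Compression

/-! ### Abstract unilateral shifts -/

/-- `T` is a unilateral shift with respect to the orthonormal basis `e`. -/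
structure IsUnilateralShift {H : Type*} [NormedAddCommGroup H] [InnerProductSpace ℂ H]
    (T : H →L[ℂ] H) (e : ℕ → H) : Prop where
  total : ∀ f, (∀ n, inner ℂ (e n) f = 0) → f = 0
  inner_zero_zero : inner ℂ (e 0) (e 0) = (1 : ℂ)
  apply_basis : ∀ n, T (e n) = e (n + 1)
  inner_zero_apply : ∀ f, inner ℂ (e 0) (T f) = 0
  inner_succ_apply : ∀ n f, inner ℂ (e (n + 1)) (T f) = inner ℂ (e n) f

namespace IsUnilateralShift

open ContinuousLinearMap (adjoint adjoint_inner_left adjoint_inner_right)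

variable {H : Type*} [NormedAddCommGroup H] [InnerProductSpace ℂ H] [CompleteSpace H]
  {S : H →L[ℂ] H} {e : ℕ → H}

theorem inner_adjoint_apply (hS : IsUnilateralShift S e) (n : ℕ) (f : H) :
    inner ℂ (e n) (adjoint S f) = inner ℂ (e (n + 1)) f := by
  rw [adjoint_inner_right, hS.apply_basis]

/-- This rank-one defect drives both the bound on eigenvalues and the analysis of normal
compressions. -/
theorem apply_adjoint_apply (hS : IsUnilateralShift S e) (f : H) :
    S (adjoint S f) = f - inner ℂ (e 0) f • e 0 := by
  refine sub_eq_zero.1 (hS.total _ fun m => ?_)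
  cases m with
  | zero =>
    rw [inner_sub_right, inner_sub_right, inner_smul_right, hS.inner_zero_apply,
      hS.inner_zero_zero, mul_one, sub_self, sub_self]
  | succ m =>
    have : inner ℂ (e (m + 1)) (e 0) = (0 : ℂ) := by
      rw [← hS.apply_basis, ← inner_conj_symm, hS.inner_zero_apply, map_zero]
    rw [inner_sub_right, inner_sub_right, inner_smul_right, hS.inner_succ_apply,
      hS.inner_adjoint_apply, this, mul_zero, sub_zero, sub_self]

theorem adjoint_apply_apply (hS : IsUnilateralShift S e) (f : H) : adjoint S (S f) = f :=
  sub_eq_zero.1 (hS.total _ fun m => by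
    rw [inner_sub_right, hS.inner_adjoint_apply, hS.inner_succ_apply, sub_self])

theorem norm_apply (hS : IsUnilateralShift S e) (f : H) : ‖S f‖ = ‖f‖ := by
  rw [@norm_eq_sqrt_re_inner ℂ, ← adjoint_inner_right, hS.adjoint_apply_apply,
    ← @norm_eq_sqrt_re_inner ℂ]

/-- A Neumann series inverts I - `conj a • S`, since `S` is an isometry and `‖a‖ < 1`. For the Hardy
shift this clears the denominator of a disc automorphism. -/
theorem exists_sub_smul_apply (hS : IsUnilateralShift S e) {a : ℂ} (ha : ‖a‖ < 1) (g : H) :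
    ∃ h, h - conj a • S h = g := by
  have hS1 : ‖S‖ ≤ 1 := ContinuousLinearMap.opNorm_le_bound _ zero_le_one fun f => by
    rw [hS.norm_apply, one_mul]
  have hlt : ‖conj a • S‖ < 1 := by
    rw [norm_smul, RCLike.norm_conj]
    exact (mul_le_of_le_one_right (norm_nonneg _) hS1).trans_lt ha
  obtain ⟨u, hu⟩ := isUnit_one_sub_of_norm_lt_one hlt
  refine ⟨(↑u⁻¹ : H →L[ℂ] H) g, ?_⟩
  have := congrArg (fun R : H →L[ℂ] H => R g) u.mul_inv
  rw [hu] at this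
  exact this

/-- The coefficients of an eigenvector satisfy a geometric recursion, so the zeroth one determines
it. -/
theorem eq_zero_of_eigenvector (hS : IsUnilateralShift S e) {μ : ℂ} {f : H}
    (h : adjoint S f = μ • f) (h0 : inner ℂ (e 0) f = 0) : f = 0 := by
  refine hS.total f fun n => ?_
  induction n with
  | zero => exact h0
  | succ n ih => rw [← hS.inner_adjoint_apply, h, inner_smul_right, ih, mul_zero]

/-- The defect identity gives ‖S*f‖² = ‖f‖² - |⟨e₀, f⟩|², and the zeroth coefficient of a nonzero
eigenvector does not vanish. -/
theorem norm_lt_one_of_eigenvector (hS : IsUnilateralShift S e) {μ : ℂ} {f : H}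
    (h : adjoint S f = μ • f) (hf : f ≠ 0) : ‖μ‖ < 1 := by
  have h0 : inner ℂ (e 0) f ≠ 0 := fun h0 => hf (hS.eq_zero_of_eigenvector h h0)
  have key : inner ℂ (adjoint S f) (adjoint S f) =
      inner ℂ f f - inner ℂ (e 0) f * conj (inner ℂ (e 0) f) := by
    rw [adjoint_inner_left, hS.apply_adjoint_apply, inner_sub_right, inner_smul_right,
      inner_conj_symm]
  rw [inner_self_eq_norm_sq_to_K, inner_self_eq_norm_sq_to_K, RCLike.mul_conj, h,
    norm_smul] at key
  have key' : (‖μ‖ * ‖f‖) ^ 2 = ‖f‖ ^ 2 - ‖inner ℂ (e 0) f‖ ^ 2 := by exact_mod_cast key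
  have h1 : 0 < ‖f‖ := norm_pos_iff.2 hf
  have h2 : 0 < ‖inner ℂ (e 0) f‖ := norm_pos_iff.2 h0
  have h3 : ‖μ‖ * ‖f‖ < 1 * ‖f‖ := by
    refine lt_of_pow_lt_pow_left₀ 2 (by positivity) ?_
    rw [key', one_mul]
    linarith [pow_pos h2 2]
  exact lt_of_mul_lt_mul_right h3 h1.le

/-- Eigenspaces of the backward shift are at most one-dimensional, so a nonzero subspace of one is
the whole of it. -/
theorem norm_lt_one_and_mem_iff (hS : IsUnilateralShift S e) {Q : Submodule ℂ H} (hQ : Q ≠ ⊥)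
    {μ : ℂ} (h : ∀ f ∈ Q, adjoint S f = μ • f) :
    ‖μ‖ < 1 ∧ ∀ f, f ∈ Q ↔ adjoint S f = μ • f := by
  obtain ⟨u, huQ, hu⟩ := Submodule.exists_mem_ne_zero_of_ne_bot hQ
  refine ⟨hS.norm_lt_one_of_eigenvector (h u huQ) hu, fun f => ⟨h f, fun hf => ?_⟩⟩
  have h0 : inner ℂ (e 0) u ≠ 0 := fun h0 => hu (hS.eq_zero_of_eigenvector (h u huQ) h0)
  set d := inner ℂ (e 0) f / inner ℂ (e 0) u with hd
  have : f - d • u = 0 := by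
    refine hS.eq_zero_of_eigenvector (μ := μ) ?_ ?_
    · rw [map_sub, map_smul, hf, h u huQ, smul_sub, smul_comm]
    · rw [inner_sub_right, inner_smul_right, hd, div_mul_cancel₀ _ h0, sub_self]
  rw [sub_eq_zero.1 this]
  exact Q.smul_mem _ huQ

/-- A quotient module on which the compression of the shift is normal consists of eigenvectors of
the backward shift. -/
theorem exists_eigenvalue_of_normal (hS : IsUnilateralShift S e) {Q : Submodule ℂ H}
    [CompleteSpace Q] (hQ : IsQuotientModule {S} Q)
    (hn : ∀ f : Q, compression Q S (adjoint (compression Q S) f) =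
      adjoint (compression Q S) (compression Q S f)) :
    ∃ μ : ℂ, ∀ f ∈ Q, adjoint S f = μ • f := by
  set B := compression Q S with hB
  have hadj : ∀ f : Q, (adjoint B f : H) = adjoint S (f : H) :=
    coe_adjoint_compression hQ rfl
  set u : Q := Q.orthogonalProjectionOnto (e 0)
  have hu : ∀ f : Q, inner ℂ (e 0) (f : H) = inner ℂ u f := fun f =>
    (Submodule.inner_orthogonalProjectionOnto_eq_of_mem_right f _).symm
  -- The defect compresses to `Q`: BB* = I - u ⊗ u, with `u` the projection of `e 0`.
  have hBB : ∀ f : Q, B (adjoint B f) = f - inner ℂ u f • u := fun f => by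
    change Q.orthogonalProjectionOnto (S (adjoint B f : H)) = _
    rw [hadj, hS.apply_adjoint_apply, map_sub, map_smul, hu,
      Submodule.orthogonalProjectionOnto_mem_subspace_eq_self]
  -- Normality makes B commute with BB*, hence with u ⊗ u. In particular B u is a multiple of `u`.
  have hcomm : ∀ f : Q, inner ℂ u f • B u = inner ℂ u (B f) • u := fun f => by
    have h1 := congrArg B (hn f)
    rw [hBB f, hBB (B f), map_sub, map_smul] at h1
    exact sub_right_injective h1
  -- The complement of `u` is B*-invariant because `u` is an eigenvector of B. Iterating B*
  -- therefore kills every coefficient of `f`, so `u` spans `Q`.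
  have hort : ∀ f : Q, inner ℂ u f = 0 → f = 0 := fun f hf => by
    apply Subtype.ext
    refine hS.total _ fun n => ?_
    induction n generalizing f with
    | zero => rw [hu, hf]
    | succ n ih =>
      rw [← hS.inner_adjoint_apply, ← hadj]
      refine ih _ ?_
      rw [adjoint_inner_right]
      by_cases hu0 : u = 0
      · simp [hu0]
      have huu : inner ℂ u u ≠ 0 := inner_self_ne_zero.2 hu0
      have h2 := congrArg (fun x => inner ℂ x f) (hcomm u)
      simp only [inner_smul_left, hf, mul_zero, inner_conj_symm] at h2
      exact (mul_eq_zero.1 h2).resolve_left huu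
  have hspan : ∀ f : Q, f = (inner ℂ u f / inner ℂ u u) • u := fun f => by
    by_cases hu0 : u = 0
    · rw [hort f (by simp [hu0]), hu0, smul_zero]
    have huu : inner ℂ u u ≠ 0 := inner_self_ne_zero.2 hu0
    refine sub_eq_zero.1 (hort _ ?_)
    rw [inner_sub_right, inner_smul_right, div_mul_cancel₀ _ huu, sub_self]
  refine ⟨inner ℂ u (adjoint B u) / inner ℂ u u, fun f hf => ?_⟩
  have h3 : adjoint B ⟨f, hf⟩ = (inner ℂ u (adjoint B u) / inner ℂ u u) • ⟨f, hf⟩ := by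
    rw [hspan ⟨f, hf⟩, map_smul, smul_comm, ← hspan (adjoint B u)]
  rw [← hadj ⟨f, hf⟩, h3]
  rfl

theorem forall_inner_smul_sub_eq_zero_iff {a c : ℂ} (hc : c ≠ 0) (f : H) :
    (∀ h, inner ℂ (c • (S h - a • h)) f = 0) ↔ adjoint S f = conj a • f := by
  have key : ∀ h, inner ℂ (c • (S h - a • h)) f =
      conj c * inner ℂ h (adjoint S f - conj a • f) := by
    intro h
    rw [inner_smul_left, inner_sub_left, inner_sub_right, inner_smul_left, inner_smul_right,
      adjoint_inner_right]
  constructor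
  · intro hf
    refine sub_eq_zero.1 (ext_inner_left ℂ fun h => ?_)
    have := hf h
    rw [key] at this
    rw [(mul_eq_zero.1 this).resolve_left ((map_ne_zero _).2 hc), inner_zero_right]
  · intro hf h
    rw [key, hf, sub_self, inner_zero_right, mul_zero]

end IsUnilateralShift

/-! ### The shift of the Hardy space of the disc -/

section HardyDisc

/-- The monomial `z ^ n` as an element of `H²(𝔻)`. -/
def hardyMonomial (n : ℕ) : hardyDisc :=
  ⟨fourierLp 2 (n : ℤ), fun m hm => orthonormal_fourier.2 (by omega)⟩

theorem hardyShift_ae (f : hardyDisc) :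
    (hardyShift f : Lp ℂ 2 circleMeasure) =ᵐ[circleMeasure]
      fun t => fourier 1 t * (f : Lp ℂ 2 circleMeasure) t :=
  mulL2_ae circleMeasure (fourier 1) f

theorem norm_fourier_apply (n : ℤ) (t : UnitAddCircle) : ‖fourier n t‖ = 1 :=
  Circle.norm_coe _

theorem conj_fourier_mul_self (n : ℤ) (t : UnitAddCircle) :
    conj (fourier n t) * fourier n t = 1 := by
  rw [← fourier_neg, ← fourier_add]; simp

theorem inner_fourierLp_hardyShift (n : ℤ) (f : hardyDisc) :
    inner ℂ (fourierLp 2 (n + 1)) (hardyShift f : Lp ℂ 2 circleMeasure) =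
      inner ℂ (fourierLp 2 n) (f : Lp ℂ 2 circleMeasure) :=
  inner_mulL2 circleMeasure (fourier 1) (fourier (n + 1)) (fourier n) (fun x => by
    rw [← fourier_neg, ← fourier_neg, ← fourier_add]; congr 2; ring) (f : Lp ℂ 2 circleMeasure)

/-- An element of `L²(𝕋)` is determined by its Fourier coefficients. -/
theorem eq_zero_of_inner_fourierLp {f : Lp ℂ 2 circleMeasure}
    (h : ∀ n : ℤ, inner ℂ (fourierLp 2 n) f = 0) : f = 0 := by
  apply (fourierBasis (T := 1)).repr.injective
  ext n
  rw [HilbertBasis.repr_apply_apply, coe_fourierBasis, h, map_zero]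
  rfl

theorem hardyDisc_ext {f : hardyDisc}
    (h : ∀ n : ℕ, inner ℂ (fourierLp 2 (n : ℤ)) (f : Lp ℂ 2 circleMeasure) = 0) : f = 0 :=
  Subtype.ext <| eq_zero_of_inner_fourierLp fun n => by
    rcases lt_or_ge n 0 with hn | hn
    · exact f.2 n hn
    · lift n to ℕ using hn
      exact h n

theorem hardyShift_hardyMonomial (n : ℕ) :
    hardyShift (hardyMonomial n) = hardyMonomial (n + 1) := by
  refine Subtype.ext (Lp.ext ?_)
  filter_upwards [hardyShift_ae (hardyMonomial n), coeFn_fourierLp (T := 1) 2 (n : ℤ),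
    coeFn_fourierLp (T := 1) 2 ((n + 1 : ℕ) : ℤ)] with t h1 h2 h3
  rw [h1]
  change fourier 1 t * fourierLp 2 (n : ℤ) t = fourierLp 2 ((n + 1 : ℕ) : ℤ) t
  rw [h2, h3, ← fourier_add]
  congr 2
  push_cast
  ring

theorem inner_fourierLp_self (n : ℤ) :
    inner ℂ (fourierLp (T := 1) 2 n) (fourierLp 2 n) = (1 : ℂ) := by
  rw [inner_self_eq_norm_sq_to_K, orthonormal_fourier.1]
  simp

theorem isUnilateralShift_hardyShift : IsUnilateralShift hardyShift hardyMonomial := by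
  constructor
  · exact fun f h => hardyDisc_ext h
  · exact inner_fourierLp_self 0
  · exact hardyShift_hardyMonomial
  · intro f
    have h := inner_fourierLp_hardyShift (-1) f
    rw [f.2 (-1) (by norm_num)] at h
    exact h
  · exact fun n f => inner_fourierLp_hardyShift n f

/-! ### The model space of a disc automorphism -/

open ContinuousLinearMap (adjoint)

theorem one_sub_conj_mul_fourier_ne_zero {a : ℂ} (ha : ‖a‖ < 1) (t : UnitAddCircle) :
    1 - conj a * fourier 1 t ≠ 0 := fun h => by
  have := congrArg norm (sub_eq_zero.1 h)
  rw [norm_mul, RCLike.norm_conj, norm_fourier_apply, norm_one, mul_one] at this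
  exact ha.ne' this

theorem discAut_mul_ae {a : ℂ} (ha : ‖a‖ < 1) (c : ℂ) (h : hardyDisc) :
    ((c • (hardyShift h - a • h) : hardyDisc) : Lp ℂ 2 circleMeasure) =ᵐ[circleMeasure]
      fun t => discAut a c t *
        ((h - conj a • hardyShift h : hardyDisc) : Lp ℂ 2 circleMeasure) t := by
  simp only [Submodule.coe_smul, Submodule.coe_sub]
  filter_upwards [hardyShift_ae h,
    Lp.coeFn_smul c ((hardyShift h : Lp ℂ 2 circleMeasure) - a • (h : Lp ℂ 2 circleMeasure)),
    Lp.coeFn_sub (hardyShift h : Lp ℂ 2 circleMeasure) (a • (h : Lp ℂ 2 circleMeasure)),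
    Lp.coeFn_smul a (h : Lp ℂ 2 circleMeasure),
    Lp.coeFn_sub (h : Lp ℂ 2 circleMeasure) (conj a • (hardyShift h : Lp ℂ 2 circleMeasure)),
    Lp.coeFn_smul (conj a) (hardyShift h : Lp ℂ 2 circleMeasure)] with t h1 h2 h3 h4 h5 h6
  have h0 := one_sub_conj_mul_fourier_ne_zero ha t
  simp only [h2, h3, h4, h5, h6, h1, Pi.smul_apply, Pi.sub_apply, smul_eq_mul, discAut]
  rw [mul_assoc c, div_mul_eq_mul_div, ← mul_assoc (conj a), ← one_sub_mul,
    mul_left_comm, mul_div_cancel_left₀ _ h0, sub_mul]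

/-- Every g in H² has the form (1 - `conj a` z)h, and multiplying by the automorphism cancels the
denominator. -/
theorem mem_mulHardy_discAut {a : ℂ} (ha : ‖a‖ < 1) (c : ℂ) (f : hardyDisc) :
    f ∈ mulHardy (discAut a c) ↔ ∃ h, f = c • (hardyShift h - a • h) := by
  constructor
  · rintro ⟨g, hg⟩
    obtain ⟨h, rfl⟩ := isUnilateralShift_hardyShift.exists_sub_smul_apply ha g
    exact ⟨h, Subtype.ext (Lp.ext (hg.trans (discAut_mul_ae ha c h).symm))⟩
  · rintro ⟨h, rfl⟩
    exact ⟨_, discAut_mul_ae ha c h⟩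

theorem mem_modelSpace_discAut {a c : ℂ} (ha : ‖a‖ < 1) (hc : ‖c‖ = 1) (f : hardyDisc) :
    f ∈ modelSpace (discAut a c) ↔ adjoint hardyShift f = conj a • f := by
  have hc0 : c ≠ 0 := fun h => by simp [h] at hc
  refine Iff.trans ?_ (IsUnilateralShift.forall_inner_smul_sub_eq_zero_iff hc0 f)
  rw [modelSpace, Submodule.mem_orthogonal]
  constructor
  · exact fun hf h => hf _ ((mem_mulHardy_discAut ha c _).2 ⟨h, rfl⟩)
  · intro hf g hg
    obtain ⟨h, rfl⟩ := (mem_mulHardy_discAut ha c _).1 hg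
    exact hf h

/-- A unimodular function which is the boundary function of an element of `H²(𝔻)` is inner. -/
theorem isInner_of_ae_eq {θ : UnitAddCircle → ℂ} (f : hardyDisc)
    (hf : (f : Lp ℂ 2 circleMeasure) =ᵐ[circleMeasure] θ) (h1 : ∀ᵐ t ∂circleMeasure, ‖θ t‖ = 1) :
    IsInner θ where
  aestronglyMeasurable := (Lp.aestronglyMeasurable _).congr hf
  norm_eq_one := h1
  fourierCoeff_eq_zero n hn := by
    rw [← fourierCoeff_congr_ae hf, ← fourierBasis_repr, HilbertBasis.repr_apply_apply,
      coe_fourierBasis]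
    exact f.2 n hn

theorem isInner_discAut {a c : ℂ} (ha : ‖a‖ < 1) (hc : ‖c‖ = 1) : IsInner (discAut a c) := by
  -- Here h is the boundary function of 1/(1 - `conj a` z), so c(z - a)h is the automorphism itself.
  obtain ⟨h, hh⟩ :=
    isUnilateralShift_hardyShift.exists_sub_smul_apply ha (hardyMonomial 0)
  refine isInner_of_ae_eq (c • (hardyShift h - a • h)) ?_ (Filter.Eventually.of_forall fun t => ?_)
  · filter_upwards [discAut_mul_ae ha c h, coeFn_fourierLp (T := 1) 2 0] with t h1 h2
    rw [h1, hh]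
    change _ * fourierLp 2 0 t = _
    rw [h2, fourier_zero, mul_one]
  · have h0 := one_sub_conj_mul_fourier_ne_zero ha t
    -- On the circle this exhibits numerator and denominator with equal modulus.
    have : fourier 1 t - a = fourier 1 t * conj (1 - conj a * fourier 1 t) := by
      simp only [map_sub, map_one, map_mul, RCLike.conj_conj]
      linear_combination a * conj_fourier_mul_self 1 t
    rw [discAut, this, norm_mul, norm_div, norm_mul, RCLike.norm_conj, norm_fourier_apply, hc,
      one_mul, one_mul, div_self (norm_ne_zero_iff.2 h0)]

end HardyDisc

/-! ### Beurling's theorem -/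

section Wandering

open ContinuousLinearMap (adjoint adjoint_inner_left adjoint_inner_right)

variable {H : Type*} [NormedAddCommGroup H] [InnerProductSpace ℂ H]

/-- The complement of a proper quotient module of a unilateral shift contains a wandering unit
vector. -/
theorem IsUnilateralShift.exists_wandering {S : H →L[ℂ] H} {e : ℕ → H}
    (hS : IsUnilateralShift S e) {Q : Submodule ℂ H} [CompleteSpace Q] (hQ : Q ≠ ⊤) :
    ∃ u ∈ Qᗮ, ‖u‖ = 1 ∧ ∀ g ∈ Qᗮ, S g ∈ Qᗮ → inner ℂ u (S g) = 0 := by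
  classical
  have hbot : Qᗮ ≠ ⊥ := fun h => hQ ((Submodule.orthogonal_eq_bot_iff).1 h)
  obtain ⟨g₀, hg₀, hne⟩ := Submodule.exists_mem_ne_zero_of_ne_bot hbot
  have hex : ∃ n, ∃ g ∈ Qᗮ, inner ℂ (e n) g ≠ 0 := by
    by_contra! h
    exact hne (hS.total g₀ fun n => h n g₀ hg₀)
  obtain ⟨g, hg, hgk⟩ := Nat.find_spec hex
  have hmin : ∀ n < Nat.find hex, ∀ g ∈ Qᗮ, inner ℂ (e n) g = 0 := by
    intro n hn g hg
    by_contra h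
    exact Nat.find_min hex hn ⟨g, hg, h⟩
  -- `k` is the least order of vanishing at the origin among elements of the complement. The
  -- projection `v` of `e k` represents the k-th coefficient there, and applying `S` moves in a
  -- lower coefficient, which is 0.
  generalize Nat.find hex = k at hgk hmin
  set v : Qᗮ := Qᗮ.orthogonalProjectionOnto (e k)
  have hv : ∀ g ∈ Qᗮ, inner ℂ (v : H) g = inner ℂ (e k) g := fun g hg =>
    Submodule.inner_orthogonalProjectionOnto_eq_of_mem_right (⟨g, hg⟩ : Qᗮ) (e k)
  have hv0 : (v : H) ≠ 0 := fun h => hgk (by rw [← hv g hg, h, inner_zero_left])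
  refine ⟨((‖(v : H)‖⁻¹ : ℝ) : ℂ) • (v : H), Qᗮ.smul_mem _ v.2, ?_, fun g hg hSg => ?_⟩
  · rw [norm_smul, Complex.norm_real, norm_inv, norm_norm, inv_mul_cancel₀ (norm_ne_zero_iff.2 hv0)]
  · rw [inner_smul_left, hv _ hSg]
    cases k with
    | zero => rw [hS.inner_zero_apply, mul_zero]
    | succ k => rw [hS.inner_succ_apply, hmin k (Nat.lt_succ_self k) g hg, mul_zero]

variable [CompleteSpace H]

theorem IsQuotientModule.apply_mem_orthogonal {M : Set (H →L[ℂ] H)} {Q : Submodule ℂ H}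
    (hQ : IsQuotientModule M Q) {S : H →L[ℂ] H} (hS : S ∈ M) {g : H} (hg : g ∈ Qᗮ) :
    S g ∈ Qᗮ := by
  rw [Submodule.mem_orthogonal] at hg ⊢
  intro f hf
  rw [← adjoint_inner_left]
  exact hg _ (hQ.adjoint_mem S hS f hf)

theorem IsQuotientModule.iterate_apply_mem_orthogonal {M : Set (H →L[ℂ] H)} {Q : Submodule ℂ H}
    (hQ : IsQuotientModule M Q) {S : H →L[ℂ] H} (hS : S ∈ M) {g : H} (hg : g ∈ Qᗮ) (n : ℕ) :
    S^[n] g ∈ Qᗮ := by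
  induction n with
  | zero => exact hg
  | succ n ih =>
    rw [Function.iterate_succ_apply']
    exact hQ.apply_mem_orthogonal hS ih

end Wandering

section Beurling

theorem inner_mulL2_fourier_left (n : ℤ) (f g : Lp ℂ 2 circleMeasure) :
    inner ℂ (mulL2 circleMeasure (fourier n) f) g =
      inner ℂ f (mulL2 circleMeasure (fourier (-n)) g) := by
  rw [L2.inner_def, L2.inner_def]
  refine integral_congr_ae ?_
  filter_upwards [mulL2_ae circleMeasure (fourier n) f,
    mulL2_ae circleMeasure (fourier (-n)) g] with t h1 h2
  simp only [RCLike.inner_apply, h1, h2, map_mul, fourier_neg]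
  ring

theorem mulL2_fourier_zero (f : Lp ℂ 2 circleMeasure) :
    mulL2 circleMeasure (fourier 0) f = f := by
  refine Lp.ext ?_
  filter_upwards [mulL2_ae circleMeasure (fourier 0) f] with t h
  rw [h, fourier_zero, one_mul]

theorem coe_iterate_hardyShift (n : ℕ) (f : hardyDisc) :
    ((hardyShift^[n] f : hardyDisc) : Lp ℂ 2 circleMeasure) =
      mulL2 circleMeasure (fourier n) (f : Lp ℂ 2 circleMeasure) := by
  induction n with
  | zero => rw [Nat.cast_zero, mulL2_fourier_zero]; rfl
  | succ n ih =>
    rw [Function.iterate_succ_apply']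
    refine Lp.ext ?_
    have h1 := hardyShift_ae (hardyShift^[n] f)
    rw [ih] at h1
    filter_upwards [h1, mulL2_ae circleMeasure (fourier n) (f : Lp ℂ 2 circleMeasure),
      mulL2_ae circleMeasure (fourier ((n + 1 : ℕ) : ℤ)) (f : Lp ℂ 2 circleMeasure)]
      with t h1 h2 h3
    rw [h1, h2, h3, ← mul_assoc, ← fourier_add]
    congr 3
    push_cast
    ring

/-- The functional `u ↦ ∫ u |F|²` on continuous functions. -/
def integralMulNormSq (F : Lp ℂ 2 circleMeasure) : C(UnitAddCircle, ℂ) →L[ℂ] ℂ :=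
  innerSL ℂ F ∘L ((ContinuousLinearMap.mul ℂ ℂ).holderL circleMeasure ∞ 2 2).flip F ∘L
    ContinuousMap.toLp (E := ℂ) ∞ circleMeasure ℂ

theorem integralMulNormSq_apply (F : Lp ℂ 2 circleMeasure) (u : C(UnitAddCircle, ℂ)) :
    integralMulNormSq F u = inner ℂ F (mulL2 circleMeasure u F) :=
  rfl

theorem integralMulNormSq_eq (F : Lp ℂ 2 circleMeasure) (u : C(UnitAddCircle, ℂ)) :
    integralMulNormSq F u = ∫ t, u t * (‖F t‖ ^ 2 : ℝ) ∂circleMeasure := by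
  rw [integralMulNormSq_apply, L2.inner_def]
  refine integral_congr_ae ?_
  filter_upwards [mulL2_ae circleMeasure u F] with t h
  rw [RCLike.inner_apply, h, mul_assoc, RCLike.mul_conj]
  norm_cast

/-- A unit vector of `L²(𝕋)` which is orthogonal to all its shifts is unimodular. -/
theorem norm_eq_one_of_inner_mulL2_fourier (F : Lp ℂ 2 circleMeasure)
    (h0 : ‖F‖ = 1) (h : ∀ n ≠ 0, inner ℂ F (mulL2 circleMeasure (fourier n) F) = 0) :
    ∀ᵐ t ∂circleMeasure, ‖F t‖ = 1 := by
  -- The measures |F|² dm and dm have the same Fourier coefficients. Density of trigonometric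
  -- polynomials makes their integrals of continuous functions agree, so the measures coincide and
  -- |F|² = 1 almost everywhere.
  have key : integralMulNormSq F = integralMulNormSq (fourierLp 2 0) := by
    refine ContinuousLinearMap.ext_on (s := Set.range (fourier (T := 1))) ?_ ?_
    · exact Submodule.dense_iff_topologicalClosure_eq_top.2 span_fourier_closure_eq_top
    · rintro _ ⟨n, rfl⟩
      have h2 : mulL2 circleMeasure (fourier n) (fourierLp 2 0) = fourierLp 2 n := by
        refine Lp.ext ?_
        filter_upwards [mulL2_ae circleMeasure (fourier n) (fourierLp 2 0),
          coeFn_fourierLp (T := 1) 2 n, coeFn_fourierLp (T := 1) 2 0] with t a b c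
        rw [a, b, c, fourier_zero, mul_one]
      rw [integralMulNormSq_apply, integralMulNormSq_apply, h2]
      by_cases hn : n = 0
      · rw [hn, mulL2_fourier_zero, inner_fourierLp_self, inner_self_eq_norm_sq_to_K, h0]
        simp
      · rw [h n hn]
        exact (orthonormal_fourier.2 (Ne.symm hn)).symm
  have hint : Integrable (fun t => ‖F t‖ ^ 2) circleMeasure :=
    (memLp_two_iff_integrable_sq_norm (Lp.aestronglyMeasurable F)).1 (Lp.memLp F)
  have hmeas : AEMeasurable (fun t => ENNReal.ofReal (‖F t‖ ^ 2)) circleMeasure :=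
    hint.aemeasurable.ennreal_ofReal
  have := isFiniteMeasure_withDensity_ofReal hint.2
  have hν : circleMeasure.withDensity (fun t => ENNReal.ofReal (‖F t‖ ^ 2)) = circleMeasure := by
    refine ext_of_forall_integral_eq_of_IsFiniteMeasure fun f => ?_
    rw [integral_withDensity_eq_integral_toReal_smul₀ hmeas
      (Filter.Eventually.of_forall fun _ => ENNReal.ofReal_lt_top)]
    have h1 := DFunLike.congr_fun key ⟨fun t => (f t : ℂ), by fun_prop⟩
    rw [integralMulNormSq_eq, integralMulNormSq_eq] at h1
    have h2 : ∫ t, (f t : ℂ) * (‖F t‖ ^ 2 : ℝ) ∂circleMeasure =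
        ∫ t, (f t : ℂ) ∂circleMeasure := by
      refine h1.trans (integral_congr_ae ?_)
      filter_upwards [coeFn_fourierLp (T := 1) 2 0] with t a
      rw [a, fourier_zero]
      simp
    rw [← Complex.ofReal_inj, ← integral_complex_ofReal, ← integral_complex_ofReal, ← h2]
    congr 1
    ext t
    rw [ENNReal.toReal_ofReal (by positivity), smul_eq_mul, mul_comm, Complex.ofReal_mul]
  have hae := (withDensity_eq_iff (g := 1) hmeas aemeasurable_const (by
    rw [← setLIntegral_univ, ← withDensity_apply _ MeasurableSet.univ]
    exact measure_ne_top _ _)).1 (hν.trans withDensity_one.symm)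
  filter_upwards [hae] with t ht
  rw [Pi.one_apply, ENNReal.ofReal_eq_one] at ht
  exact (pow_eq_one_iff_of_nonneg (norm_nonneg _) two_ne_zero).1 ht

/-- Multiplication by the conjugate of a unimodular function, as the adjoint of multiplication. -/
theorem exists_conj_mul {F : Lp ℂ 2 circleMeasure} (hF : ∀ᵐ t ∂circleMeasure, ‖F t‖ = 1)
    (f : Lp ℂ 2 circleMeasure) :
    ∃ k : Lp ℂ 2 circleMeasure, (k =ᵐ[circleMeasure] fun t => conj (F t) * f t) ∧
      ∀ g h : Lp ℂ 2 circleMeasure, (h =ᵐ[circleMeasure] fun t => F t * g t) →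
        inner ℂ g k = inner ℂ h f := by
  have hmem : MemLp (fun t => conj (F t) * f t) 2 circleMeasure := by
    refine (Lp.memLp f).of_le ((RCLike.continuous_conj.comp_aestronglyMeasurable
      (Lp.aestronglyMeasurable F)).mul (Lp.aestronglyMeasurable f)) ?_
    filter_upwards [hF] with t ht
    rw [norm_mul, RCLike.norm_conj, ht, one_mul]
  refine ⟨hmem.toLp, hmem.coeFn_toLp, fun g h hgh => ?_⟩
  rw [L2.inner_def, L2.inner_def]
  refine integral_congr_ae ?_
  filter_upwards [hmem.coeFn_toLp, hgh] with t h1 h2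
  simp only [RCLike.inner_apply, h1, h2, map_mul]
  ring

/-- By Parseval: at each index one of the two coefficients vanishes. -/
theorem inner_eq_zero_of_mem_hardyDisc {g : hardyDisc} {k : Lp ℂ 2 circleMeasure}
    (h : ∀ n : ℕ, inner ℂ (fourierLp 2 (n : ℤ)) k = 0) :
    inner ℂ (g : Lp ℂ 2 circleMeasure) k = 0 := by
  refine (((fourierBasis (T := 1)).hasSum_inner_mul_inner (g : Lp ℂ 2 circleMeasure) k).unique
    ?_)
  convert hasSum_zero with n
  rw [coe_fourierBasis]
  rcases lt_or_ge n 0 with hn | hn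
  · rw [← inner_conj_symm, g.2 n hn, map_zero, zero_mul]
  · lift n to ℕ using hn
    rw [h n, mul_zero]

/-- **Beurling's theorem**: the proper quotient modules of `H²(𝔻)` are the model spaces. -/
theorem exists_eq_modelSpace {Q : Submodule ℂ hardyDisc} (hQ : IsQuotientModule {hardyShift} Q)
    (htop : Q ≠ ⊤) : ∃ θ, IsInner θ ∧ Q = modelSpace θ := by
  have : CompleteSpace Q := hQ.isClosed.completeSpace_coe
  obtain ⟨φ, hφQ, hφ1, hφ⟩ := isUnilateralShift_hardyShift.exists_wandering htop
  set F : Lp ℂ 2 circleMeasure := φ.1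
  have hwand : ∀ g ∈ Qᗮ, ∀ n : ℕ,
      inner ℂ F (mulL2 circleMeasure (fourier ((n + 1 : ℕ) : ℤ)) (g : Lp ℂ 2 circleMeasure)) =
        0 := by
    intro g hg n
    rw [← coe_iterate_hardyShift, Function.iterate_succ_apply']
    have h1 := hQ.iterate_apply_mem_orthogonal rfl hg n
    exact hφ _ h1 (hQ.apply_mem_orthogonal rfl h1)
  have hnorm : ∀ᵐ t ∂circleMeasure, ‖F t‖ = 1 := by
    refine norm_eq_one_of_inner_mulL2_fourier F hφ1 fun n hn => ?_
    obtain ⟨m, rfl | rfl⟩ := n.eq_nat_or_neg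
    · obtain ⟨m, rfl⟩ := Nat.exists_eq_succ_of_ne_zero (Int.natCast_ne_zero.1 hn)
      exact hwand φ hφQ m
    · obtain ⟨m, rfl⟩ := Nat.exists_eq_succ_of_ne_zero
        (Int.natCast_ne_zero.1 (neg_ne_zero.1 hn))
      rw [← inner_mulL2_fourier_left, ← inner_conj_symm]
      exact (map_eq_zero _).2 (hwand φ hφQ m)
  have hshift : ∀ n : ℤ, (mulL2 circleMeasure (fourier n) F : Lp ℂ 2 circleMeasure)
      =ᵐ[circleMeasure] fun t => F t * fourierLp 2 n t := fun n => by
    filter_upwards [mulL2_ae circleMeasure (fourier n) F, coeFn_fourierLp (T := 1) 2 n] with t a b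
    rw [a, b, mul_comm]
  -- For f in `Q`, the function `conj F * f` has no coefficients of nonnegative index, because each
  -- zⁿφ lies in the complement of `Q`; hence it is orthogonal to H².
  have hle : Q ≤ modelSpace F := by
    intro f hf
    obtain ⟨k, -, hk⟩ := exists_conj_mul hnorm (f : Lp ℂ 2 circleMeasure)
    rw [modelSpace, Submodule.mem_orthogonal]
    rintro h ⟨g, hg⟩
    refine (hk _ _ hg).symm.trans (inner_eq_zero_of_mem_hardyDisc fun n => ?_)
    rw [hk _ _ (hshift n), ← coe_iterate_hardyShift]
    exact (Submodule.mem_orthogonal' _ _).1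
      (hQ.iterate_apply_mem_orthogonal rfl hφQ n) f hf
  refine ⟨F, isInner_of_ae_eq φ Filter.EventuallyEq.rfl hnorm, le_antisymm hle fun f hf => ?_⟩
  obtain ⟨q, hq, m, hm, rfl⟩ := Q.exists_add_mem_mem_orthogonal f
  have hmF : m ∈ modelSpace F := (Submodule.add_mem_iff_right _ (hle hq)).1 hf
  obtain ⟨k, hkae, hk⟩ := exists_conj_mul hnorm (m : Lp ℂ 2 circleMeasure)
  -- All coefficients of `conj F * m` vanish: those of negative index because φ is orthogonal to the
  -- positive shifts of `m`, the others because `m` is orthogonal to φH².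
  have hk0 : k = 0 := by
    refine eq_zero_of_inner_fourierLp fun n => ?_
    rw [hk _ _ (hshift n)]
    rcases lt_or_ge n 0 with hn | hn
    · obtain ⟨j, rfl⟩ := Int.eq_negSucc_of_lt_zero hn
      rw [inner_mulL2_fourier_left]
      exact hwand m hm j
    · lift n to ℕ using hn
      rw [← coe_iterate_hardyShift]
      refine (Submodule.mem_orthogonal _ _).1 hmF (hardyShift^[n] φ) ⟨hardyMonomial n, ?_⟩
      rw [coe_iterate_hardyShift]
      exact hshift n
  have hm0 : m = 0 := by
    refine Subtype.ext (Lp.ext ?_)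
    rw [hk0] at hkae
    filter_upwards [hkae, hnorm, Lp.coeFn_zero ℂ 2 circleMeasure] with t a b c
    rw [c, Pi.zero_apply] at a
    have hFt : F t ≠ 0 := fun h => by rw [h, norm_zero] at b; exact zero_ne_one b
    rw [(mul_eq_zero.1 a.symm).resolve_left ((map_ne_zero _).2 hFt)]
    exact c.symm
  rw [hm0, add_zero]
  exact hq

end Beurling

/-! ### Compressions to tensor products -/

/-- `Q` is the Hilbert space tensor product of `Q₁` and `Q₂`, with elementary tensors `τ f g`. -/
structure IsHilbertTensor {H K : Type*} [NormedAddCommGroup H] [InnerProductSpace ℂ H]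
    [NormedAddCommGroup K] [InnerProductSpace ℂ K] (τ : H → H → K)
    (Q₁ Q₂ : Submodule ℂ H) (Q : Submodule ℂ K) : Prop where
  inner_eq : ∀ f g f' g', inner ℂ (τ f g) (τ f' g') = inner ℂ f f' * inner ℂ g g'
  mem : ∀ f ∈ Q₁, ∀ g ∈ Q₂, τ f g ∈ Q
  total : ∀ x ∈ Q, (∀ f ∈ Q₁, ∀ g ∈ Q₂, inner ℂ (τ f g) x = 0) → x = 0

namespace IsHilbertTensor

open ContinuousLinearMap (adjoint adjoint_inner_left adjoint_inner_right)

variable {H K : Type*} [NormedAddCommGroup H] [InnerProductSpace ℂ H]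
  [NormedAddCommGroup K] [InnerProductSpace ℂ K]
  {τ : H → H → K} {Q₁ Q₂ : Submodule ℂ H} {Q : Submodule ℂ K}

/-- The elementary tensor as an element of the tensor product. -/
def tmul (h : IsHilbertTensor τ Q₁ Q₂ Q) (f : Q₁) (g : Q₂) : Q :=
  ⟨τ f g, h.mem f f.2 g g.2⟩

theorem inner_tmul (h : IsHilbertTensor τ Q₁ Q₂ Q) (f f' : Q₁) (g g' : Q₂) :
    inner ℂ (h.tmul f g) (h.tmul f' g') = inner ℂ f f' * inner ℂ g g' :=
  h.inner_eq f g f' g'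

theorem ext_inner (h : IsHilbertTensor τ Q₁ Q₂ Q) {x y : Q}
    (hxy : ∀ f g, inner ℂ (h.tmul f g) x = inner ℂ (h.tmul f g) y) : x = y := by
  refine Subtype.ext (sub_eq_zero.1 (h.total _ (Q.sub_mem x.2 y.2) fun f hf g hg => ?_))
  rw [inner_sub_right, sub_eq_zero]
  exact hxy ⟨f, hf⟩ ⟨g, hg⟩

theorem ne_bot (h : IsHilbertTensor τ Q₁ Q₂ Q) (hQ : Q ≠ ⊥) : Q₁ ≠ ⊥ ∧ Q₂ ≠ ⊥ := by
  obtain ⟨x, hx, hx0⟩ := Submodule.exists_mem_ne_zero_of_ne_bot hQ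
  have hτ : ∀ f g, f = 0 ∨ g = 0 → τ f g = 0 := by
    intro f g hfg
    rw [← inner_self_eq_zero (𝕜 := ℂ), h.inner_eq]
    rcases hfg with rfl | rfl <;> simp
  constructor
  · rintro rfl
    refine hx0 (h.total x hx fun f hf g _ => ?_)
    rw [hτ f g (Or.inl ((Submodule.mem_bot ℂ).1 hf)), inner_zero_left]
  · rintro rfl
    refine hx0 (h.total x hx fun f _ g hg => ?_)
    rw [hτ f g (Or.inr ((Submodule.mem_bot ℂ).1 hg)), inner_zero_left]

variable [CompleteSpace Q]

/-- Totality is available only through inner products, hence the passage to adjoints. -/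
theorem clm_ext (h : IsHilbertTensor τ Q₁ Q₂ Q) {X Y : Q →L[ℂ] Q}
    (hXY : ∀ f g, X (h.tmul f g) = Y (h.tmul f g)) : X = Y := by
  refine (ContinuousLinearMap.adjoint (𝕜 := ℂ) (E := Q) (F := Q)).injective ?_
  ext1 x
  refine h.ext_inner fun f g => ?_
  rw [adjoint_inner_right, adjoint_inner_right, hXY]

variable {S : H →L[ℂ] H} {M₁ M₂ : K →L[ℂ] K}

theorem compression_left [CompleteSpace Q₁] (h : IsHilbertTensor τ Q₁ Q₂ Q)
    (hM₁ : ∀ f g, M₁ (τ f g) = τ (S f) g) (f : Q₁) (g : Q₂) :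
    compression Q M₁ (h.tmul f g) = h.tmul (compression Q₁ S f) g := by
  refine h.ext_inner fun f' g' => ?_
  rw [inner_tmul, Submodule.coe_inner, Submodule.coe_inner Q₁, inner_coe_compression,
    inner_coe_compression, Submodule.coe_inner Q₂, ← h.inner_eq, ← hM₁]
  rfl

theorem compression_right [CompleteSpace Q₂] (h : IsHilbertTensor τ Q₁ Q₂ Q)
    (hM₂ : ∀ f g, M₂ (τ f g) = τ f (S g)) (f : Q₁) (g : Q₂) :
    compression Q M₂ (h.tmul f g) = h.tmul f (compression Q₂ S g) := by
  refine h.ext_inner fun f' g' => ?_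
  rw [inner_tmul, Submodule.coe_inner, Submodule.coe_inner Q₂, inner_coe_compression,
    inner_coe_compression, Submodule.coe_inner Q₁, ← h.inner_eq, ← hM₂]
  rfl

theorem adjoint_compression_right [CompleteSpace Q₂]
    (h : IsHilbertTensor τ Q₁ Q₂ Q)
    (hM₂ : ∀ f g, M₂ (τ f g) = τ f (S g)) (f : Q₁) (g : Q₂) :
    adjoint (compression Q M₂) (h.tmul f g) = h.tmul f (adjoint (compression Q₂ S) g) := by
  refine h.ext_inner fun f' g' => ?_
  rw [adjoint_inner_right, h.compression_right hM₂, inner_tmul, inner_tmul, adjoint_inner_right]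

/-- On f ⊗ g the identity is Af ⊗ BB*g = Af ⊗ B*Bg. Choosing f with Af ≠ 0 and pairing with Af ⊗ k,
the factor ‖Af‖² cancels. -/
theorem eq_zero_or_normal_of_isPhiDoublyCommuting [CompleteSpace Q₁] [CompleteSpace Q₂]
    (h : IsHilbertTensor τ Q₁ Q₂ Q)
    [CompleteSpace K] (hM₁ : ∀ f g, M₁ (τ f g) = τ (S f) g)
    (hM₂ : ∀ f g, M₂ (τ f g) = τ f (S g)) (hφ : IsPhiDoublyCommuting M₁ M₂ Q) :
    compression Q₁ S = 0 ∨
      ∀ g, compression Q₂ S (adjoint (compression Q₂ S) g) =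
        adjoint (compression Q₂ S) (compression Q₂ S g) := by
  rw [or_iff_not_imp_left]
  intro hA g
  obtain ⟨f, hf⟩ := DFunLike.ne_iff.1 hA
  have h1 := DFunLike.congr_fun hφ (h.tmul f g)
  simp only [ContinuousLinearMap.comp_apply] at h1
  rw [h.adjoint_compression_right hM₂, h.compression_right hM₂, h.compression_right hM₂,
    h.compression_left hM₁, h.compression_left hM₁, h.adjoint_compression_right hM₂] at h1
  refine ext_inner_left ℂ fun k => ?_
  have h2 := congrArg (fun x => inner ℂ (h.tmul (compression Q₁ S f) k) x) h1
  simp only [inner_tmul] at h2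
  exact mul_left_cancel₀ (inner_self_ne_zero.2 hf) h2

theorem isPhiDoublyCommuting_of_left_eq_zero [CompleteSpace Q₁]
    (h : IsHilbertTensor τ Q₁ Q₂ Q)
    [CompleteSpace K] (hM₁ : ∀ f g, M₁ (τ f g) = τ (S f) g)
    (hA : compression Q₁ S = 0) : IsPhiDoublyCommuting M₁ M₂ Q := by
  have h1 : compression Q M₁ = 0 := h.clm_ext fun f g => h.ext_inner fun f' g' => by
    rw [h.compression_left hM₁, hA, inner_tmul]
    simp
  rw [IsPhiDoublyCommuting, h1]
  simp

theorem isPhiDoublyCommuting_of_right_eq_smul [CompleteSpace Q₂]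
    (h : IsHilbertTensor τ Q₁ Q₂ Q)
    [CompleteSpace K] (hM₂ : ∀ f g, M₂ (τ f g) = τ f (S g)) {a : ℂ}
    (hB : compression Q₂ S = a • ContinuousLinearMap.id ℂ Q₂) :
    IsPhiDoublyCommuting M₁ M₂ Q := by
  have h2 : compression Q M₂ = a • ContinuousLinearMap.id ℂ Q :=
    h.clm_ext fun f g => h.ext_inner fun f' g' => by
      rw [h.compression_right hM₂, hB, inner_tmul, smul_apply,
        smul_apply, ContinuousLinearMap.id_apply,
        ContinuousLinearMap.id_apply, inner_smul_right, inner_smul_right, inner_tmul]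
      ring
  have h3 : adjoint (compression Q M₂) = conj a • ContinuousLinearMap.id ℂ Q := by
    ext1 x
    refine ext_inner_left ℂ fun y => ?_
    rw [adjoint_inner_right, h2]
    simp [inner_smul_left, inner_smul_right]
  rw [IsPhiDoublyCommuting, h3, h2]
  ext1 x
  simp [smul_smul, mul_comm]

end IsHilbertTensor

/-! ### Tensor products of quotient modules of the Hardy space -/

section Bidisc

open ContinuousLinearMap (adjoint)

theorem pureTensor_ae (f g : hardyDisc) :
    (pureTensor f g : Lp ℂ 2 torusMeasure) =ᵐ[torusMeasure] fun p =>
      (f : Lp ℂ 2 circleMeasure) p.1 * (g : Lp ℂ 2 circleMeasure) p.2 :=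
  (memLp_pureTensor f g).coeFn_toLp

theorem inner_coe_pureTensor (f g f' g' : hardyDisc) :
    inner ℂ (pureTensor f g : Lp ℂ 2 torusMeasure) (pureTensor f' g' : Lp ℂ 2 torusMeasure) =
      inner ℂ (f : Lp ℂ 2 circleMeasure) (f' : Lp ℂ 2 circleMeasure) *
        inner ℂ (g : Lp ℂ 2 circleMeasure) (g' : Lp ℂ 2 circleMeasure) := by
  rw [L2.inner_def, L2.inner_def, L2.inner_def, ← integral_prod_mul]
  refine integral_congr_ae ?_
  filter_upwards [pureTensor_ae f g, pureTensor_ae f' g'] with p h1 h2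
  simp only [RCLike.inner_apply, h1, h2, map_mul]
  ring

theorem bidiscShift₁_pureTensor (f g : hardyDisc) :
    bidiscShift₁ (pureTensor f g) = pureTensor (hardyShift f) g := by
  refine Subtype.ext (Lp.ext ?_)
  filter_upwards [mulL2_ae torusMeasure (torusMonomial 1 0) (pureTensor f g : Lp ℂ 2 torusMeasure),
    pureTensor_ae f g, pureTensor_ae (hardyShift f) g,
    Measure.quasiMeasurePreserving_fst.ae (hardyShift_ae f)] with p h1 h2 h3 h4
  refine h1.trans ?_
  rw [h2, h3, h4]
  simp only [torusMonomial, ContinuousMap.coe_mk, fourier_zero]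
  ring

theorem bidiscShift₂_pureTensor (f g : hardyDisc) :
    bidiscShift₂ (pureTensor f g) = pureTensor f (hardyShift g) := by
  refine Subtype.ext (Lp.ext ?_)
  filter_upwards [mulL2_ae torusMeasure (torusMonomial 0 1) (pureTensor f g : Lp ℂ 2 torusMeasure),
    pureTensor_ae f g, pureTensor_ae f (hardyShift g),
    Measure.quasiMeasurePreserving_snd.ae (hardyShift_ae g)] with p h1 h2 h3 h4
  refine h1.trans ?_
  rw [h2, h3, h4]
  simp only [torusMonomial, ContinuousMap.coe_mk, fourier_zero]
  ring

theorem eq_zero_of_mem_topologicalClosure_span {K : Type*} [NormedAddCommGroup K]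
    [InnerProductSpace ℂ K] {s : Set K} {x : K}
    (hx : x ∈ (Submodule.span ℂ s).topologicalClosure) (h : ∀ y ∈ s, inner ℂ y x = 0) : x = 0 := by
  have h1 : x ∈ (Submodule.span ℂ s)ᗮ := by
    rw [Submodule.mem_orthogonal]
    intro u hu
    induction hu using Submodule.span_induction with
    | mem y hy => exact h y hy
    | zero => exact inner_zero_left _
    | add y z _ _ hy hz => rw [inner_add_left, hy, hz, add_zero]
    | smul c y _ hy => rw [inner_smul_left, hy, mul_zero]
  rw [← Submodule.orthogonal_closure] at h1
  exact inner_self_eq_zero.1 ((Submodule.mem_orthogonal _ _).1 h1 x hx)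

theorem isHilbertTensor_tensorSubspace (Q₁ Q₂ : Submodule ℂ hardyDisc) :
    IsHilbertTensor pureTensor Q₁ Q₂ (tensorSubspace Q₁ Q₂) := by
  constructor
  · exact inner_coe_pureTensor
  · exact fun f hf g hg => Submodule.le_topologicalClosure _
      (Submodule.subset_span ⟨f, hf, g, hg, rfl⟩)
  · intro x hx h
    refine eq_zero_of_mem_topologicalClosure_span hx ?_
    rintro _ ⟨f, hf, g, hg, rfl⟩
    exact h f hf g hg

/-- The zero of the automorphism is the conjugate of the eigenvalue. The unimodular constant does
not affect the model space and is taken to be 1. -/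
theorem exists_eq_modelSpace_discAut_of_eigenvalue {Q : Submodule ℂ hardyDisc} (hQ : Q ≠ ⊥) {μ : ℂ}
    (h : ∀ f ∈ Q, adjoint hardyShift f = μ • f) :
    ‖conj μ‖ < 1 ∧ Q = modelSpace (discAut (conj μ) 1) := by
  obtain ⟨h1, h2⟩ := isUnilateralShift_hardyShift.norm_lt_one_and_mem_iff hQ h
  have h3 : ‖conj μ‖ < 1 := by rwa [RCLike.norm_conj]
  refine ⟨h3, Submodule.ext fun f => ?_⟩
  rw [mem_modelSpace_discAut h3 norm_one, RCLike.conj_conj]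
  exact h2 f

end Bidisc

end

/-! ### The characterization of φ-doubly commuting tensor products. -/

theorem theorem3p5 (Q₁ Q₂ : Submodule ℂ hardyDisc)
    (hQ₁ : IsQuotientModule {hardyShift} Q₁) (hQ₂ : IsQuotientModule {hardyShift} Q₂)
    (hQ : IsQuotientModule {bidiscShift₁, bidiscShift₂} (tensorSubspace Q₁ Q₂))
    (hne : tensorSubspace Q₁ Q₂ ≠ ⊥)
    (hdc : IsDoublyCommuting bidiscShift₁ bidiscShift₂ (tensorSubspace Q₁ Q₂)) :
    IsPhiDoublyCommuting bidiscShift₁ bidiscShift₂ (tensorSubspace Q₁ Q₂) ↔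
      (∃ a c : ℂ, ‖a‖ < 1 ∧ ‖c‖ = 1 ∧ Q₁ = ⊤ ∧ Q₂ = modelSpace (discAut a c)) ∨
      (∃ c : ℂ, ‖c‖ = 1 ∧ Q₁ = modelSpace (discAut 0 c) ∧ Q₂ = ⊤) ∨
      (∃ θ₁ θ₂ : UnitAddCircle → ℂ, IsInner θ₁ ∧ IsInner θ₂ ∧
        Q₁ = modelSpace θ₁ ∧ Q₂ = modelSpace θ₂ ∧
        ((∃ c : ℂ, ‖c‖ = 1 ∧ θ₁ = discAut 0 c) ∨
          (∃ a c : ℂ, ‖a‖ < 1 ∧ ‖c‖ = 1 ∧ θ₂ = discAut a c))) := by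
  have : CompleteSpace Q₁ := hQ₁.isClosed.completeSpace_coe
  have : CompleteSpace Q₂ := hQ₂.isClosed.completeSpace_coe
  have hτ := isHilbertTensor_tensorSubspace Q₁ Q₂
  obtain ⟨hne₁, hne₂⟩ := hτ.ne_bot hne
  have hleft : ∀ c : ℂ, ‖c‖ = 1 → Q₁ = modelSpace (discAut 0 c) →
      IsPhiDoublyCommuting bidiscShift₁ bidiscShift₂ (tensorSubspace Q₁ Q₂) := by
    intro c hc h
    have h0 : ‖(0 : ℂ)‖ < 1 := by simp
    refine hτ.isPhiDoublyCommuting_of_left_eq_zero bidiscShift₁_pureTensor ?_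
    refine (compression_eq_zero_iff hQ₁ rfl).2 fun f hf => ?_
    have := (mem_modelSpace_discAut h0 hc f).1 (h ▸ hf)
    rwa [map_zero] at this
  have hright : ∀ a c : ℂ, ‖a‖ < 1 → ‖c‖ = 1 → Q₂ = modelSpace (discAut a c) →
      IsPhiDoublyCommuting bidiscShift₁ bidiscShift₂ (tensorSubspace Q₁ Q₂) := by
    intro a c ha hc h
    exact hτ.isPhiDoublyCommuting_of_right_eq_smul bidiscShift₂_pureTensor
      (compression_eq_smul hQ₂ rfl fun f hf => (mem_modelSpace_discAut ha hc f).1 (h ▸ hf))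
  constructor
  · intro hφ
    rcases hτ.eq_zero_or_normal_of_isPhiDoublyCommuting bidiscShift₁_pureTensor
      bidiscShift₂_pureTensor hφ with hA | hB
    · have h0 := (compression_eq_zero_iff hQ₁ rfl).1 hA
      obtain ⟨hlt, hQ₁'⟩ := exists_eq_modelSpace_discAut_of_eigenvalue hne₁ h0
      rw [map_zero] at hlt hQ₁'
      -- The remaining factor is arbitrary; Beurling's theorem needs it proper, which separates case
      -- (ii) from case (iii), and likewise (i) from (iii) below.
      by_cases htop : Q₂ = ⊤
      · exact Or.inr (Or.inl ⟨1, norm_one, hQ₁', htop⟩)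
      · obtain ⟨θ, hθ, hQθ⟩ := exists_eq_modelSpace hQ₂ htop
        exact Or.inr (Or.inr ⟨_, θ, isInner_discAut hlt norm_one, hθ, hQ₁', hQθ,
          Or.inl ⟨1, norm_one, rfl⟩⟩)
    · obtain ⟨μ, hμ⟩ := isUnilateralShift_hardyShift.exists_eigenvalue_of_normal hQ₂ hB
      obtain ⟨hlt, hQ₂'⟩ := exists_eq_modelSpace_discAut_of_eigenvalue hne₂ hμ
      by_cases htop : Q₁ = ⊤
      · exact Or.inl ⟨_, 1, hlt, norm_one, htop, hQ₂'⟩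
      · obtain ⟨θ, hθ, hQθ⟩ := exists_eq_modelSpace hQ₁ htop
        exact Or.inr (Or.inr ⟨θ, _, hθ, isInner_discAut hlt norm_one, hQθ, hQ₂',
          Or.inr ⟨_, 1, hlt, norm_one, rfl⟩⟩)
  · rintro (⟨a, c, ha, hc, -, h⟩ | ⟨c, hc, h, -⟩ | ⟨θ₁, θ₂, -, -, h₁, h₂, h⟩)
    · exact hright a c ha hc h
    · exact hleft c hc h
    · rcases h with ⟨c, hc, rfl⟩ | ⟨a, c, ha, hc, rfl⟩
      · exact hleft c hc h₁
      · exact hright a c ha hc h₂
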